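/- Let $f:\mathbb{Z}^n\to\mathbb{R}\cup\{+\infty\}$, with $\operatorname{dom} f=\{x\mid f(x)<+\infty\}$. A set $S\subseteq\mathbb{Z}^n$ is discrete midpoint convex if $\lceil\frac{x+y}{2}\rceil,\lfloor\frac{x+y}{2}\rfloor\in S$ (componentwise rounding) for all $x,y\in S$ with $\|x-y\|_\infty\ge 2$. The function $f$ is globally discrete midpoint convex if $$f(x)+f(y)\ \ge\ f\left(\left\lceil\tfrac{x+y}{2}\right\rceil\right)+f\left(\left\lfloor\tfrac{x+y}{2}\right\rfloor\right)$$ for all $x,y\in\mathbb{Z}^n$ with $\|x-y\|_\infty\ge 2$; it is locally discrete midpoint convex if $\operatorname{dom} f$ is a discrete midpoint convex set and the inequality holds for all $x,y\in\mathbb{Z}^n$ with $\|x-y\|_\infty=2$. Let $f$ be locally or globally discrete midpoint convex with bounded $\operatorname{dom} f$, and suppose $K_\infty=\max\{\|x-y\|_\infty\mid x,y\in\operatorname{dom} f\}>0$. Consider the following scaling algorithm, for which an initial $x\in\operatorname{dom} f$ and the number $K_\infty$ are given. - S0: Set $\alpha:=2^{\lceil\log_2 K_\infty\rceil}$. - S1: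 Find $y$ that minimizes $f^\alpha(y)=f(x+\alpha y)$ subject to $\|y\|_\infty\le n$ by the 2-neighborhood steepest descent algorithm (below), and set $x:=x+\alpha y$. - S2: If $\alpha=1$, output $x$ and stop. - S3: Set $\alpha:=\alpha/2$ and go to S1. The 2-neighborhood steepest descent algorithm used in S1 is as follows, where $x^{(0)}=\mathbf{0}$, $N_2(c)=\{z\in\mathbb{Z}^n\mid\|z-c\|_\infty\le 2\}$ and $S_k=\{z\in\mathbb{Z}^n\mid\|z\|_\infty\le\min(k,n)\}$. - D0: Find $x^{(2)}$ that minimizes $f^\alpha$ in $S_2$, and set $k:=3$. - D1: Find $x^{(k)}$ that minimizes $f^\alpha$ in $N_2(x^{(k-1)})\cap S_k$. - D2: If $f^\alpha(x^{(k)})=f^\alpha(x^{(k-1)})$, output $x^{(k-1)}$ and stop. - D3: Set $k:=k+1$ and go to D1. The minimizations in D0 and D1 are done by a 2-neighborhood minimization oracle, that is, a subroutine which, for each function $g(y)=f(x+\alpha y)$ with $x\in\operatorname{dom} f$ and an integer $\alpha\ge1$, each $c\in\operatorname{dom} g$ and each box $B\subseteq\mathbb{Z}^n$ containing $c$, finds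 a minimizer of $g$ in $N_2(c)\cap B$. Let $F(n)\ge 1$ be an upper bound on the number of function evaluations it needs. Then the scaling algorithm terminates and outputs a minimizer of $f$, and the number of evaluations of $f$ is at most $$C\, n\, F(n)\,\max\{1,\log_2 K_\infty\},$$ that is, $O(n F(n)\log_2 K_\infty)$ when $K_\infty\ge 2$. Here $C>0$ is an absolute constant, independent of $n$, $f$, the initial point and the oracle. Moreover, for each $n$ there is an oracle of this kind, valid for all functions $g:\mathbb{Z}^n\to\mathbb{R}\cup\{+\infty\}$, that needs at most $5^n$ evaluations; with it, the number of evaluations is at most $C\,5^n\, n\,\max\{1,\log_2 K_\infty\}$, that is, $O(5^n n\log_2 K_\infty)$ when $K_\infty\ge 2$. -/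

import Mathlib

/-! Functions `f : ℤⁿ → ℝ ∪ {+∞}` are modelled as `(Fin n → ℤ) → WithTop ℝ`.  The distance `dist`
on `Fin n → ℤ` is Mathlib's sup distance, i.e. the `ℓ_∞`-distance. -/

/-- The effective domain `dom f = {x | f x < +∞}`. -/
def effDom {n : ℕ} (f : (Fin n → ℤ) → WithTop ℝ) : Set (Fin n → ℤ) :=
  {x | f x < ⊤}

/-- The rounded-up midpoint `⌈(x + y) / 2⌉` (componentwise). -/
def midUp {n : ℕ} (x y : Fin n → ℤ) : Fin n → ℤ :=
  fun i => ⌈((x i + y i : ℤ) : ℚ) / 2⌉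

/-- The rounded-down midpoint `⌊(x + y) / 2⌋` (componentwise). -/
def midDown {n : ℕ} (x y : Fin n → ℤ) : Fin n → ℤ :=
  fun i => ⌊((x i + y i : ℤ) : ℚ) / 2⌋

/-- Discrete midpoint convex sets. -/
def DiscreteMidpointConvexSet {n : ℕ} (S : Set (Fin n → ℤ)) : Prop :=
  ∀ x ∈ S, ∀ y ∈ S, 2 ≤ dist x y → midUp x y ∈ S ∧ midDown x y ∈ S

/-- Locally discrete midpoint convex functions. -/
def LocallyDiscreteMidpointConvex {n : ℕ} (f : (Fin n → ℤ) → WithTop ℝ) : Prop :=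
  DiscreteMidpointConvexSet (effDom f) ∧
    ∀ x y : Fin n → ℤ, dist x y = 2 → f (midUp x y) + f (midDown x y) ≤ f x + f y

/-- Globally discrete midpoint convex functions. -/
def GloballyDiscreteMidpointConvex {n : ℕ} (f : (Fin n → ℤ) → WithTop ℝ) : Prop :=
  ∀ x y : Fin n → ℤ, 2 ≤ dist x y → f (midUp x y) + f (midDown x y) ≤ f x + f y

/-- The `ℓ_∞`-size `K_∞ = max {‖x - y‖_∞ | x, y ∈ dom f}` of a (bounded) effective domain. -/
noncomputable def domSize {n : ℕ} (f : (Fin n → ℤ) → WithTop ℝ) : ℝ :=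
  Metric.diam (effDom f)

/-- The scaled function with origin `x` and scaling unit `a`: `y ↦ f (x + a y)`. -/
def scaledFun {n : ℕ} (f : (Fin n → ℤ) → WithTop ℝ) (x : Fin n → ℤ) (a : ℕ) :
    (Fin n → ℤ) → WithTop ℝ :=
  fun y => f (x + a • y)

/-- A program that has access to a function `f : ℤⁿ → ℝ ∪ {+∞}` only through function evaluations:
it either returns a result, or asks for the value of `f` at a point and continues depending on
the answer. -/
inductive EvalProg (n : ℕ) (β : Type) : Type
  | done (b : β) : EvalProg n β
  | ask (x : Fin n → ℤ) (k : WithTop ℝ → EvalProg n β) : EvalProg n β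

namespace EvalProg

/-- Sequential composition. -/
def bind {n : ℕ} {β γ : Type} : EvalProg n β → (β → EvalProg n γ) → EvalProg n γ
  | done b, g => g b
  | ask x k, g => ask x fun v => (k v).bind g

/-- Run the program on the function `y ↦ f (x + a y)`: every evaluation at `y` is carried out as
one evaluation of `f` at `x + a y`. -/
def rescale {n : ℕ} {β : Type} (x : Fin n → ℤ) (a : ℕ) : EvalProg n β → EvalProg n β
  | done b => done b
  | ask y k => ask (x + a • y) fun v => (k v).rescale x a

/-- The result of the program when the function is `f`. -/
def result {n : ℕ} {β : Type} (f : (Fin n → ℤ) → WithTop ℝ) : EvalProg n β → β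
  | done b => b
  | ask x k => (k (f x)).result f

/-- The number of function evaluations of the program when the function is `f`. -/
def evals {n : ℕ} {β : Type} (f : (Fin n → ℤ) → WithTop ℝ) : EvalProg n β → ℕ
  | done _ => 0
  | ask x k => (k (f x)).evals f + 1

end EvalProg

/-- Subroutines that, given a centre `c` and the corners `p`, `q` of a box, return a point. -/
abbrev NbhdSubroutine (n : ℕ) : Type :=
  (c p q : Fin n → ℤ) → EvalProg n (Fin n → ℤ)

/-- `O` is a 2-neighborhood minimization oracle for `g` that needs at most `F` function
evaluations: for every `c ∈ dom g` and every box `[p, q]` containing `c` it finds a minimizer of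
`g` in `N₂(c) ∩ [p, q]`, where `N₂(c) = {z | ‖z - c‖_∞ ≤ 2}`. -/
def IsTwoNbhdOracle {n : ℕ} (O : NbhdSubroutine n) (g : (Fin n → ℤ) → WithTop ℝ) (F : ℕ) : Prop :=
  ∀ c p q : Fin n → ℤ, c ∈ effDom g → c ∈ Set.Icc p q →
    (dist ((O c p q).result g) c ≤ 2 ∧ (O c p q).result g ∈ Set.Icc p q) ∧
    (∀ z : Fin n → ℤ, dist z c ≤ 2 → z ∈ Set.Icc p q → g ((O c p q).result g) ≤ g z) ∧
    (O c p q).evals g ≤ F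

/-- States of the 2-neighborhood steepest descent algorithm. -/
inductive DescentState (n : ℕ) : Type
  /-- before step D0 -/
  | start : DescentState n
  /-- before step D1, with the current index `k` and the point `y = x^(k-1)` -/
  | loop (k : ℕ) (y : Fin n → ℤ) : DescentState n
  /-- stopped with output `y` -/
  | output (y : Fin n → ℤ) : DescentState n

open Classical in
/-- The 2-neighborhood steepest descent algorithm with initial point `x^(0) = 0`, for minimization
subject to the constraint `‖y‖_∞ ≤ r`.  Write `S_k = {y | ‖y‖_∞ ≤ k}`; under the constraint, `S_k`
becomes the box `[-min(k,r), min(k,r)]ⁿ`.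

* D0: find `x^(2)` that minimizes the function in `S_2`, and set `k := 3`.
* D1: find `x^(k)` that minimizes the function in `N₂(x^(k-1)) ∩ S_k`.
* D2: if the values at `x^(k)` and `x^(k-1)` are equal, then output `x^(k-1)` and stop.
* D3: set `k := k + 1`, and go to D1. -/
noncomputable def descentStep {n : ℕ} (O : NbhdSubroutine n) (r : ℕ) :
    DescentState n → EvalProg n (DescentState n)
  | .start =>
      (O 0 (fun _ => -((min 2 r : ℕ) : ℤ)) (fun _ => ((min 2 r : ℕ) : ℤ))).bind fun z =>
        .done (.loop 3 z)
  | .loop k y =>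
      (O y (fun _ => -((min k r : ℕ) : ℤ)) (fun _ => ((min k r : ℕ) : ℤ))).bind fun z =>
        .ask z fun v => .ask y fun w =>
          if v = w then .done (.output y) else .done (.loop (k + 1) z)
  | .output y => .done (.output y)

/-- States of the scaling algorithm. -/
inductive ScalingState (n : ℕ) : Type
  /-- within step S1, with the current vector `x`, the scaling unit `a`, and the state of the
  2-neighborhood steepest descent algorithm for `y ↦ f (x + a y)` -/
  | phase (x : Fin n → ℤ) (a : ℕ) (d : DescentState n) : ScalingState n
  /-- before step S2 -/
  | check (x : Fin n → ℤ) (a : ℕ) : ScalingState n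
  /-- stopped with output `x` -/
  | halted (x : Fin n → ℤ) : ScalingState n

/-- The scaling algorithm.

* S1: find a vector `y` that minimizes `y ↦ f (x + a y)` subject to `‖y‖_∞ ≤ n`, by the
  2-neighborhood steepest descent algorithm started at `0`, and set `x := x + a y`.
* S2: if `a = 1`, then stop.
* S3: set `a := a / 2`, and go to S1. -/
noncomputable def scalingStep {n : ℕ} (O : NbhdSubroutine n) :
    ScalingState n → EvalProg n (ScalingState n)
  | .phase x a (.output y) => .done (.check (x + a • y) a)
  | .phase x a d => ((descentStep O n d).rescale x a).bind fun d' => .done (.phase x a d')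
  | .check x a => if a = 1 then .done (.halted x) else .done (.phase x (a / 2) .start)
  | .halted x => .done (.halted x)

/-- One step of the scaling algorithm for `f` on a pair consisting of the current state and the
number of evaluations of `f` made so far. -/
noncomputable def scalingNext {n : ℕ} (O : NbhdSubroutine n) (f : (Fin n → ℤ) → WithTop ℝ)
    (s : ScalingState n × ℕ) : ScalingState n × ℕ :=
  ((scalingStep O s.1).result f, s.2 + (scalingStep O s.1).evals f)

/-- The scaling algorithm for `f`, with the 2-neighborhood minimizations done by `O`, with initial
vector `x₀` and initial scaling unit `2 ^ ⌈log₂ K_∞⌉` (step S0), stops with output `x` after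
exactly `c` evaluations of `f`. -/
def ScalingHaltsWith {n : ℕ} (O : NbhdSubroutine n) (f : (Fin n → ℤ) → WithTop ℝ)
    (x₀ x : Fin n → ℤ) (c : ℕ) : Prop :=
  ∃ t : ℕ, (scalingNext O f)^[t]
    (.phase x₀ (2 ^ ⌈Real.logb 2 (domSize f)⌉₊) .start, 0) = (.halted x, c)

/-! Write a difference d = y - x of ℓ_∞-norm m as the sum of the m vectors 1_{d ≥ m-k} - 1_{d ≤
-(k+1)}, k < m (`unitPart`). They increase with k, and where |d| = m they are all 1 or all -1. If x
and y lie in dom f, so does x plus the sum of any subset of these parts. On this cube of points f is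
finite, and the inequality at distance 2 makes it supermodular as a function of the subset. Hence
the parallelogram inequality f(x+s) + f(y-s) ≤ f(x) + f(y) for every subset sum s, and the exchange
rule: if f(x) ≤ f(x+s), then replacing y by y - s does not increase f.

Three choices of s carry the algorithm. The part k = 0 shows that minimality in the unit ball is
global minimality (`le_of_forall_unit_ball`). The part k = 1 shows that, from a minimizer over a box
of radius r, searching within distance 2 suffices for the box of radius r + 1
(`exists_le_near_of_box`), so the k-th descent iterate minimizes over S_k. If m > n, two consecutive
parts coincide and their sum is an even vector, so around a minimizer c over c + 2ℤⁿ the ball of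
radius n contains, for each z, a point no worse than z (`exists_le_near_of_le_two_mul`).

Scaling by 2 preserves local discrete midpoint convexity, so all this holds at every scale 2^j. At
the first scale all feasible points are within distance 1; afterwards the proximity bound n makes
the box-constrained minimum global. There are ⌈log₂ K_∞⌉ + 1 phases with O(n) oracle calls each.
Global convexity implies local convexity, so one argument covers both. -/

/-! ### Rounded midpoints and ℓ_∞-distance in integer arithmetic -/

theorem midUp_apply {n : ℕ} (x y : Fin n → ℤ) (i : Fin n) :
    midUp x y i = (x i + y i + 1) / 2 := by
  unfold midUp
  rw [Int.ceil_eq_iff]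
  have h1 : 2 * ((x i + y i + 1) / 2) ≤ x i + y i + 1 := by omega
  have h2 : x i + y i ≤ 2 * ((x i + y i + 1) / 2) := by omega
  have h1' : (2 * (((x i + y i + 1) / 2 : ℤ) : ℚ)) ≤ ((x i + y i : ℤ) : ℚ) + 1 := by
    exact_mod_cast h1
  have h2' : ((x i + y i : ℤ) : ℚ) ≤ 2 * (((x i + y i + 1) / 2 : ℤ) : ℚ) := by
    exact_mod_cast h2
  constructor <;> linarith

theorem midDown_apply {n : ℕ} (x y : Fin n → ℤ) (i : Fin n) :
    midDown x y i = (x i + y i) / 2 := by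
  unfold midDown
  rw [Int.floor_eq_iff]
  have h1 : 2 * ((x i + y i) / 2) ≤ x i + y i := by omega
  have h2 : x i + y i ≤ 2 * ((x i + y i) / 2) + 1 := by omega
  have h1' : (2 * (((x i + y i) / 2 : ℤ) : ℚ)) ≤ ((x i + y i : ℤ) : ℚ) := by
    exact_mod_cast h1
  have h2' : ((x i + y i : ℤ) : ℚ) ≤ 2 * (((x i + y i) / 2 : ℤ) : ℚ) + 1 := by
    exact_mod_cast h2
  constructor <;> linarith

theorem dist_le_natCast_iff {n : ℕ} (x y : Fin n → ℤ) (m : ℕ) :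
    dist x y ≤ m ↔ ∀ i, -(m : ℤ) ≤ y i - x i ∧ y i - x i ≤ m := by
  rw [dist_pi_le_iff (Nat.cast_nonneg m)]
  refine forall_congr' fun i => ?_
  rw [Int.dist_eq, ← Int.cast_sub, ← Int.cast_abs, ← Int.cast_natCast, Int.cast_le, abs_le]
  omega

theorem two_le_dist_iff {n : ℕ} (x y : Fin n → ℤ) :
    2 ≤ dist x y ↔ ∃ i, 2 ≤ y i - x i ∨ y i - x i ≤ -2 := by
  constructor
  · intro h
    by_contra hc
    push Not at hc
    have : dist x y ≤ (1 : ℕ) := by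
      rw [dist_le_natCast_iff]
      intro i
      have := hc i
      push_cast
      omega
    push_cast at this
    linarith
  · rintro ⟨i, hi⟩
    refine le_trans ?_ (dist_le_pi_dist x y i)
    rw [Int.dist_eq, ← Int.cast_sub, ← Int.cast_abs]
    have : (2 : ℤ) ≤ |x i - y i| := by
      rw [le_abs]
      omega
    exact_mod_cast this

theorem DiscreteMidpointConvexSet.up {n : ℕ} {S : Set (Fin n → ℤ)}
    (hS : DiscreteMidpointConvexSet S) {x y z : Fin n → ℤ} (hx : x ∈ S) (hy : y ∈ S)
    (h : ∃ i, 2 ≤ y i - x i ∨ y i - x i ≤ -2) (hz : ∀ i, z i = (x i + y i + 1) / 2) : z ∈ S := by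
  have : z = midUp x y := funext fun i => by rw [hz, midUp_apply]
  rw [this]
  exact (hS x hx y hy ((two_le_dist_iff x y).2 h)).1

theorem DiscreteMidpointConvexSet.down {n : ℕ} {S : Set (Fin n → ℤ)}
    (hS : DiscreteMidpointConvexSet S) {x y z : Fin n → ℤ} (hx : x ∈ S) (hy : y ∈ S)
    (h : ∃ i, 2 ≤ y i - x i ∨ y i - x i ≤ -2) (hz : ∀ i, z i = (x i + y i) / 2) : z ∈ S := by
  have : z = midDown x y := funext fun i => by rw [hz, midDown_apply]
  rw [this]
  exact (hS x hx y hy ((two_le_dist_iff x y).2 h)).2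

/-! ### Decomposition into unit parts inside discrete midpoint convex sets -/

/-- The `k`-th summand (counting from `0`) in the canonical decomposition of an integer `t` with
`|t| ≤ m` into `m` summands from `{-1, 0, 1}`. -/
def unitPart (m k : ℕ) (t : ℤ) : ℤ :=
  (if (m : ℤ) - k ≤ t then 1 else 0) - (if t ≤ -(k + 1 : ℤ) then 1 else 0)

/-- The vector `d` has `ℓ_∞`-norm `m`. -/
def HasSupNorm {n : ℕ} (m : ℕ) (d : Fin n → ℤ) : Prop :=
  (∀ i, -(m : ℤ) ≤ d i ∧ d i ≤ m) ∧ ∃ i, d i = m ∨ d i = -m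

theorem Set.mem_of_forall_eq {n : ℕ} {S : Set (Fin n → ℤ)} {x y : Fin n → ℤ} (hx : x ∈ S)
    (h : ∀ i, y i = x i) : y ∈ S := by
  rwa [show y = x from funext h]

/-- The first part of the difference can be moved, for differences of even norm or of norm attained
with only one sign. -/
theorem DiscreteMidpointConvexSet.add_unitPart_zero_aux {n : ℕ} {S : Set (Fin n → ℤ)}
    (hS : DiscreteMidpointConvexSet S) {m j : ℕ} (hm : 2 ≤ m)
    (IH : ∀ x ∈ S, ∀ y ∈ S, HasSupNorm j (y - x) →
      (fun i => x i + unitPart j 0 (y i - x i)) ∈ S ∧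
      (fun i => y i - unitPart j 0 (y i - x i)) ∈ S)
    {x y : Fin n → ℤ} (hx : x ∈ S) (hy : y ∈ S) (hd : HasSupNorm m (y - x))
    (hj : m = 2 * j ∨ (m + 1 = 2 * j ∧ ∀ i, y i - x i ≠ m)) :
    (fun i => x i + unitPart m 0 (y i - x i)) ∈ S ∧
      (fun i => y i - unitPart m 0 (y i - x i)) ∈ S := by
  obtain ⟨hb, i₀, hi₀⟩ := hd
  simp only [Pi.sub_apply] at hb hi₀
  have far : ∃ i, 2 ≤ y i - x i ∨ y i - x i ≤ -2 := ⟨i₀, by omega⟩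
  have hp : (fun i => (x i + y i + 1) / 2) ∈ S := hS.up hx hy far fun _ => rfl
  have hq : (fun i => (x i + y i) / 2) ∈ S := hS.down hx hy far fun _ => rfl
  have hne : ∀ i, m = 2 * j ∨ (m + 1 = 2 * j ∧ y i - x i ≠ m) := fun i =>
    hj.imp id fun h => ⟨h.1, h.2 i⟩
  -- Both the step from x to the floor midpoint and the step from the ceiling midpoint to y equal
  -- ⌊d/2⌋. It has norm j, and its part 0 agrees with that of d.
  have h1 := (IH x hx _ hq ⟨fun i => by
      have := hb i; have := hne i; simp only [Pi.sub_apply]; omega, i₀, by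
      have := hne i₀; simp only [Pi.sub_apply]; omega⟩).1
  have h2 := (IH _ hp y hy ⟨fun i => by
      have := hb i; have := hne i; simp only [Pi.sub_apply]; omega, i₀, by
      have := hne i₀; simp only [Pi.sub_apply]; omega⟩).2
  constructor
  · refine Set.mem_of_forall_eq h1 fun i => ?_
    have := hb i
    have := hne i
    simp only [unitPart]
    split_ifs <;> omega
  · refine Set.mem_of_forall_eq h2 fun i => ?_
    have := hb i
    have := hne i
    simp only [unitPart]
    split_ifs <;> omega

/-- Halving the difference by midpoints works by strong induction on m unless m is odd and the value
m occurs. Then ⌊d/2⌋ fails to single out the coordinates with d = m, and the move 1_{d = m} - 1_{d <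
0} is assembled from simpler moves. -/
theorem DiscreteMidpointConvexSet.add_unitPart_zero {n : ℕ} {S : Set (Fin n → ℤ)}
    (hS : DiscreteMidpointConvexSet S) (m : ℕ) (hm : 1 ≤ m) :
    ∀ x ∈ S, ∀ y ∈ S, HasSupNorm m (y - x) →
      (fun i => x i + unitPart m 0 (y i - x i)) ∈ S ∧
      (fun i => y i - unitPart m 0 (y i - x i)) ∈ S := by
  induction m using Nat.strong_induction_on with
  | _ m IH =>
  intro x hx y hy hd
  rcases Nat.lt_or_ge m 2 with hm2 | hm2
  · obtain rfl : m = 1 := by omega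
    have hb := hd.1
    simp only [Pi.sub_apply] at hb
    constructor
    · refine Set.mem_of_forall_eq hy fun i => ?_
      have := hb i
      simp only [unitPart]
      split_ifs <;> omega
    · refine Set.mem_of_forall_eq hx fun i => ?_
      have := hb i
      simp only [unitPart]
      split_ifs <;> omega
  rcases Nat.even_or_odd' m with ⟨j, hj | hj⟩
  · exact hS.add_unitPart_zero_aux hm2 (IH j (by omega) (by omega)) hx hy hd (.inl hj)
  have noPlus : ∀ x ∈ S, ∀ y ∈ S, HasSupNorm m (y - x) → (∀ i, y i - x i ≠ m) →
      (fun i => x i + unitPart m 0 (y i - x i)) ∈ S ∧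
      (fun i => y i - unitPart m 0 (y i - x i)) ∈ S := fun x hx y hy hd h =>
    hS.add_unitPart_zero_aux hm2 (IH (j + 1) (by omega) (by omega)) hx hy hd
      (.inr ⟨by omega, h⟩)
  have noMinus : ∀ x ∈ S, ∀ y ∈ S, HasSupNorm m (y - x) → (∀ i, y i - x i ≠ -m) →
      (fun i => x i + unitPart m 0 (y i - x i)) ∈ S ∧
      (fun i => y i - unitPart m 0 (y i - x i)) ∈ S := by
    intro x hx y hy hd h
    obtain ⟨hb, i₀, hi₀⟩ := hd
    simp only [Pi.sub_apply] at hb hi₀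
    -- With x and y exchanged the part is -1_{d > 0}. Moving y by it leaves a difference of norm m -
    -- 1, whose part 0 is the wanted one.
    obtain ⟨hy', hx'⟩ := noPlus y hy x hx
      ⟨fun i => by have := hb i; simp only [Pi.sub_apply]; omega, i₀, by
        simp only [Pi.sub_apply]; omega⟩ fun i => by have := h i; omega
    have e : ∀ i, unitPart m 0 (x i - y i) = if 1 ≤ y i - x i then -1 else 0 := fun i => by
      have := hb i
      have := h i
      simp only [unitPart]
      split_ifs <;> omega
    simp only [e] at hx' hy'
    have h1 := (IH (m - 1) (by omega) (by omega) x hx _ hy' ⟨fun i => by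
      have := hb i; have := h i; simp only [Pi.sub_apply]; split_ifs <;> omega, i₀, by
      have := h i₀; simp only [Pi.sub_apply]; split_ifs <;> omega⟩).1
    have h2 := (IH (m - 1) (by omega) (by omega) _ hx' y hy ⟨fun i => by
      have := hb i; have := h i; simp only [Pi.sub_apply]; split_ifs <;> omega, i₀, by
      have := h i₀; simp only [Pi.sub_apply]; split_ifs <;> omega⟩).2
    constructor
    · refine Set.mem_of_forall_eq h1 fun i => ?_
      have := hb i
      have := h i
      simp only [unitPart]
      split_ifs <;> omega
    · refine Set.mem_of_forall_eq h2 fun i => ?_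
      have := hb i
      have := h i
      simp only [unitPart]
      split_ifs <;> omega
  by_cases hplus : ∀ i, y i - x i ≠ m
  · exact noPlus x hx y hy hd hplus
  by_cases hminus : ∀ i, y i - x i ≠ -m
  · exact noMinus x hx y hy hd hminus
  push Not at hplus hminus
  obtain ⟨a, ha⟩ := hplus
  obtain ⟨b, hb'⟩ := hminus
  have hb := hd.1
  simp only [Pi.sub_apply] at hb
  have far : ∃ i, 2 ≤ y i - x i ∨ y i - x i ≤ -2 := ⟨a, by omega⟩
  have hp : (fun i => (x i + y i + 1) / 2) ∈ S := hS.up hx hy far fun _ => rfl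
  have hq : (fun i => (x i + y i) / 2) ∈ S := hS.down hx hy far fun _ => rfl
  have IH' := IH (j + 1) (by omega) (by omega)
  -- the points `x - 1_{d < 0}`, `y + 1_{d < 0}`, `x + 1_{d > 0}`, `y - 1_{d > 0}`
  have x1 : (fun i => x i - if y i - x i ≤ -1 then 1 else 0) ∈ S := by
    refine Set.mem_of_forall_eq (IH' x hx _ hq ⟨fun i => by
      have := hb i; simp only [Pi.sub_apply]; omega, b, by
      simp only [Pi.sub_apply]; omega⟩).1 fun i => ?_
    have := hb i
    simp only [unitPart]
    split_ifs <;> omega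
  have y1 : (fun i => y i + if y i - x i ≤ -1 then 1 else 0) ∈ S := by
    refine Set.mem_of_forall_eq (IH' _ hp y hy ⟨fun i => by
      have := hb i; simp only [Pi.sub_apply]; omega, b, by
      simp only [Pi.sub_apply]; omega⟩).2 fun i => ?_
    have := hb i
    simp only [unitPart]
    split_ifs <;> omega
  have x2 : (fun i => x i + if 1 ≤ y i - x i then 1 else 0) ∈ S := by
    refine Set.mem_of_forall_eq (IH' _ hp x hx ⟨fun i => by
      have := hb i; simp only [Pi.sub_apply]; omega, a, by
      simp only [Pi.sub_apply]; omega⟩).2 fun i => ?_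
    have := hb i
    simp only [unitPart]
    split_ifs <;> omega
  have y2 : (fun i => y i - if 1 ≤ y i - x i then 1 else 0) ∈ S := by
    refine Set.mem_of_forall_eq (IH' y hy _ hq ⟨fun i => by
      have := hb i; simp only [Pi.sub_apply]; omega, a, by
      simp only [Pi.sub_apply]; omega⟩).1 fun i => ?_
    have := hb i
    simp only [unitPart]
    split_ifs <;> omega
  -- This point is x + 1_{d = m} - 1_{d < 0} - 1_{d ≤ -2}. Its floor midpoint with x + 1_{d > 0} is
  -- x + 1_{d = m} - 1_{d < 0}; the ceiling midpoint plays the same role at y.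
  have x3 := (noMinus _ x1 y hy ⟨fun i => by
      have := hb i; simp only [Pi.sub_apply]; split_ifs <;> omega, a, by
      simp only [Pi.sub_apply]; split_ifs <;> omega⟩ fun i => by
      have := hb i; split_ifs <;> omega).1
  have y3 := (noMinus x hx _ y1 ⟨fun i => by
      have := hb i; simp only [Pi.sub_apply]; split_ifs <;> omega, a, by
      simp only [Pi.sub_apply]; split_ifs <;> omega⟩ fun i => by
      have := hb i; split_ifs <;> omega).2
  constructor
  · refine hS.down x2 x3 ⟨b, ?_⟩ fun i => ?_
    · simp only [unitPart]
      split_ifs <;> omega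
    · have := hb i
      simp only [unitPart]
      split_ifs <;> omega
  · refine hS.up y2 y3 ⟨b, ?_⟩ fun i => ?_
    · simp only [unitPart]
      split_ifs <;> omega
    · have := hb i
      simp only [unitPart]
      split_ifs <;> omega

/-- Peeling off the first part leaves a remainder whose own decomposition is the remaining parts,
shifted by one index; this drives the inductions on m. -/
theorem unitPart_succ {m k : ℕ} {t : ℤ} (hk : k < m) (_h : -((m + 1 : ℕ) : ℤ) ≤ t)
    (h' : t ≤ (m + 1 : ℕ)) :
    unitPart m k (t - unitPart (m + 1) 0 t) = unitPart (m + 1) (k + 1) t := by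
  simp only [unitPart]
  split_ifs <;> omega

theorem sum_unitPart (m : ℕ) : ∀ t : ℤ, -(m : ℤ) ≤ t → t ≤ m →
    ∑ k ∈ Finset.range m, unitPart m k t = t := by
  induction m with
  | zero => intro t _ h'; simp; omega
  | succ m ih =>
    intro t h h'
    rw [Finset.sum_range_succ']
    have : ∀ k ∈ Finset.range m, unitPart (m + 1) (k + 1) t
        = unitPart m k (t - unitPart (m + 1) 0 t) := fun k hk =>
      (unitPart_succ (Finset.mem_range.1 hk) h h').symm
    rw [Finset.sum_congr rfl this, ih]
    · ring
    · simp only [unitPart]; split_ifs <;> omega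
    · simp only [unitPart]; split_ifs <;> omega

/-- Decide about the parts one at a time: a selected part moves x forward, a rejected one moves y
back. Either way the remaining difference has norm one less and the same later parts. -/
theorem DiscreteMidpointConvexSet.add_sum_ite_mem {n : ℕ} {S : Set (Fin n → ℤ)}
    (hS : DiscreteMidpointConvexSet S) (m : ℕ) : ∀ (b : ℕ → Bool) (x y : Fin n → ℤ), x ∈ S → y ∈ S →
    HasSupNorm m (y - x) →
    (fun i => x i + ∑ k ∈ Finset.range m, if b k then unitPart m k (y i - x i) else 0) ∈ S := by
  induction m with
  | zero => intro b x y hx _ _; simpa using hx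
  | succ m ih =>
    intro b x y hx hy hd
    obtain ⟨hx', hy'⟩ := hS.add_unitPart_zero (m + 1) (by omega) x hx y hy hd
    obtain ⟨hb, i₀, hi₀⟩ := hd
    simp only [Pi.sub_apply] at hb hi₀
    have nd : HasSupNorm m (fun i => y i - x i - unitPart (m + 1) 0 (y i - x i)) := by
      refine ⟨fun i => ?_, i₀, ?_⟩
      · have := hb i
        simp only [unitPart]; split_ifs <;> omega
      · simp only [unitPart]; split_ifs <;> omega
    have key : ∀ i, (∑ k ∈ Finset.range m, if b (k + 1) then
        unitPart m k (y i - x i - unitPart (m + 1) 0 (y i - x i)) else 0) =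
        ∑ k ∈ Finset.range m, if b (k + 1) then unitPart (m + 1) (k + 1) (y i - x i) else 0 :=
      fun i => Finset.sum_congr rfl fun k hk => by
        rw [unitPart_succ (Finset.mem_range.1 hk) (hb i).1 (hb i).2]
    cases h0 : b 0 with
    | true =>
      have e : (y - fun i => x i + unitPart (m + 1) 0 (y i - x i)) =
          fun i => y i - x i - unitPart (m + 1) 0 (y i - x i) := by
        funext i; simp only [Pi.sub_apply]; ring
      have := ih (fun k => b (k + 1)) _ y hx' hy (by rwa [e])
      refine Set.mem_of_forall_eq this fun i => ?_
      rw [Finset.sum_range_succ', ← key i, h0]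
      simp only [if_true, sub_add_eq_sub_sub]
      ring
    | false =>
      have e : ((fun i => y i - unitPart (m + 1) 0 (y i - x i)) - x) =
          fun i => y i - x i - unitPart (m + 1) 0 (y i - x i) := by
        funext i; simp only [Pi.sub_apply]; ring
      have := ih (fun k => b (k + 1)) x _ hx hy' (by rwa [e])
      refine Set.mem_of_forall_eq this fun i => ?_
      rw [Finset.sum_range_succ', ← key i, h0]
      simp only [sub_right_comm (y i)]
      simp

theorem DiscreteMidpointConvexSet.add_sum_mem {n : ℕ} {S : Set (Fin n → ℤ)}
    (hS : DiscreteMidpointConvexSet S) {m : ℕ} {x y : Fin n → ℤ} (hx : x ∈ S) (hy : y ∈ S)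
    (hd : HasSupNorm m (y - x)) {J : Finset ℕ} (hJ : J ⊆ Finset.range m) :
    (fun i => x i + ∑ k ∈ J, unitPart m k (y i - x i)) ∈ S := by
  refine Set.mem_of_forall_eq (hS.add_sum_ite_mem m (fun k => decide (k ∈ J)) x y hx hy hd)
    fun i => ?_
  simp only [decide_eq_true_eq]
  rw [← Finset.sum_filter, Finset.filter_mem_eq_inter, Finset.inter_eq_right.2 hJ]

/-! ### Supermodular set functions -/

/-- The pairwise condition says that adding one element b does not decrease the marginal gain of a;
the elements of T are added one by one. -/
theorem marginal_mono_of_local {g : Finset ℕ → ℝ} {U : Finset ℕ}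
    (h : ∀ J a b, a ∈ U → b ∈ U → J ⊆ U → a ∉ J → b ∉ J → a ≠ b →
      g (insert a J) + g (insert b J) ≤ g J + g (insert a (insert b J)))
    {J : Finset ℕ} (hJ : J ⊆ U) {a : ℕ} (ha : a ∈ U) (haJ : a ∉ J) (T : Finset ℕ) (hT : T ⊆ U)
    (hTJ : Disjoint T J) (haT : a ∉ T) :
    g (insert a J) - g J ≤ g (insert a (T ∪ J)) - g (T ∪ J) := by
  induction T using Finset.induction_on with
  | empty => simp
  | insert b T hb ih =>
    rw [Finset.insert_subset_iff] at hT
    rw [Finset.disjoint_insert_left] at hTJ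
    rw [Finset.mem_insert, not_or] at haT
    have := ih hT.2 hTJ.2 haT.2
    have := h (T ∪ J) a b ha hT.1 (Finset.union_subset hT.2 hJ) (by simp [haT.2, haJ])
      (by simp [hb, hTJ.1]) haT.1
    rw [Finset.insert_union]
    linarith

/-- Build U \ J element by element, once from ∅ and once from J: each marginal gain is at least as
large over J. -/
theorem add_compl_le_of_local {g : Finset ℕ → ℝ} {U : Finset ℕ}
    (h : ∀ J a b, a ∈ U → b ∈ U → J ⊆ U → a ∉ J → b ∉ J → a ≠ b →
      g (insert a J) + g (insert b J) ≤ g J + g (insert a (insert b J)))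
    {J : Finset ℕ} (hJ : J ⊆ U) : g J + g (U \ J) ≤ g ∅ + g U := by
  have key : ∀ W : Finset ℕ, W ⊆ U → Disjoint W J → g W - g ∅ ≤ g (W ∪ J) - g J := by
    intro W
    induction W using Finset.induction_on with
    | empty => simp
    | insert a W ha ih =>
      intro hW hd
      rw [Finset.insert_subset_iff] at hW
      rw [Finset.disjoint_insert_left] at hd
      have h1 := ih hW.2 hd.2
      have h2 := marginal_mono_of_local h hW.2 hW.1 ha J hJ hd.2.symm hd.1
      rw [Finset.insert_union, Finset.union_comm W J]
      rw [Finset.union_comm W J] at h1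
      linarith
  have := key (U \ J) Finset.sdiff_subset Finset.sdiff_disjoint
  rw [Finset.sdiff_union_of_subset hJ] at this
  linarith

/-! ### Parallelogram inequality and exchange -/

theorem mem_effDom {n : ℕ} {f : (Fin n → ℤ) → WithTop ℝ} {x : Fin n → ℤ} :
    x ∈ effDom f ↔ f x < ⊤ := Iff.rfl

/-- A finite right-hand side forces both midpoint values to be finite, which gives convexity of the
domain. -/
theorem GloballyDiscreteMidpointConvex.locally {n : ℕ} {f : (Fin n → ℤ) → WithTop ℝ}
    (hf : GloballyDiscreteMidpointConvex f) : LocallyDiscreteMidpointConvex f := by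
  refine ⟨fun x hx y hy h => ?_, fun x y h => hf x y h.ge⟩
  have := (hf x y h).trans_lt (WithTop.add_lt_top.2 ⟨hx, hy⟩)
  exact WithTop.add_lt_top.1 this

/-- Rounding twice through quarter points loses nothing; used to show that doubling the lattice
preserves the midpoint inequality. -/
theorem two_mul_ceil_midpoint (a b : ℤ) :
    2 * ((a + b + 1) / 2) = ((3 * a + b + 1) / 2 + (a + 3 * b + 1) / 2 + 1) / 2 := by
  obtain ⟨t, ht | ht⟩ : ∃ t, b = a + 2 * t ∨ b = a + 2 * t + 1 := ⟨(b - a) / 2, by omega⟩ <;>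
    subst ht <;> omega

theorem two_mul_floor_midpoint (a b : ℤ) :
    2 * ((a + b) / 2) = ((3 * a + b) / 2 + (a + 3 * b) / 2) / 2 := by
  obtain ⟨t, ht | ht⟩ : ∃ t, b = a + 2 * t ∨ b = a + 2 * t + 1 := ⟨(b - a) / 2, by omega⟩ <;>
    subst ht <;> omega

namespace LocallyDiscreteMidpointConvex

variable {n : ℕ} {f : (Fin n → ℤ) → WithTop ℝ}

theorem local_le (hf : LocallyDiscreteMidpointConvex f) {x y u v : Fin n → ℤ}
    (hd : HasSupNorm 2 (y - x)) (hu : ∀ i, u i = (x i + y i + 1) / 2)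
    (hv : ∀ i, v i = (x i + y i) / 2) : f u + f v ≤ f x + f y := by
  have hu' : u = midUp x y := funext fun i => by rw [hu, midUp_apply]
  have hv' : v = midDown x y := funext fun i => by rw [hv, midDown_apply]
  rw [hu', hv']
  refine hf.2 x y (le_antisymm ?_ ?_)
  · exact_mod_cast (dist_le_natCast_iff x y 2).2 hd.1
  · obtain ⟨i, hi⟩ := hd.2
    simp only [Pi.sub_apply] at hi
    exact (two_le_dist_iff x y).2 ⟨i, by omega⟩

/-- All four values are finite here, so the default 0 never enters and the inequality becomes one
between reals. -/
theorem local_le_untopD (hf : LocallyDiscreteMidpointConvex f) {x y u v : Fin n → ℤ}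
    (hx : x ∈ effDom f) (hy : y ∈ effDom f)
    (hd : HasSupNorm 2 (y - x)) (hu : ∀ i, u i = (x i + y i + 1) / 2)
    (hv : ∀ i, v i = (x i + y i) / 2) :
    (f u).untopD 0 + (f v).untopD 0 ≤ (f x).untopD 0 + (f y).untopD 0 := by
  have h := hf.local_le hd hu hv
  have hlt := WithTop.add_lt_top.1 (h.trans_lt (WithTop.add_lt_top.2 ⟨hx, hy⟩))
  rw [mem_effDom] at hx hy
  lift f x to ℝ using hx.ne with a
  lift f y to ℝ using hy.ne with b
  lift f u to ℝ using hlt.1.ne with c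
  lift f v to ℝ using hlt.2.ne with d
  simp only [WithTop.untopD_coe]
  exact_mod_cast h

/-- The parallelogram inequality. -/
theorem parallelogram (hf : LocallyDiscreteMidpointConvex f) {m : ℕ} {x y u v : Fin n → ℤ}
    (hx : x ∈ effDom f) (hy : y ∈ effDom f) (hd : HasSupNorm m (y - x)) {J : Finset ℕ}
    (hJ : J ⊆ Finset.range m) (hu : ∀ i, u i = x i + ∑ k ∈ J, unitPart m k (y i - x i))
    (hv : ∀ i, v i = y i - ∑ k ∈ J, unitPart m k (y i - x i)) : f u + f v ≤ f x + f y := by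
  set p : Finset ℕ → Fin n → ℤ := fun J i => x i + ∑ k ∈ J, unitPart m k (y i - x i) with hp
  have hmem : ∀ {J}, J ⊆ Finset.range m → p J ∈ effDom f := fun hJ =>
    hf.1.add_sum_mem hx hy hd hJ
  obtain ⟨hb, i₀, hi₀⟩ := hd
  simp only [Pi.sub_apply] at hb hi₀
  have hlt : ∀ J a b, a ∈ Finset.range m → b ∈ Finset.range m → J ⊆ Finset.range m → a ∉ J →
      b ∉ J → a < b → (f (p (insert b J))).untopD 0 + (f (p (insert a J))).untopD 0 ≤
        (f (p J)).untopD 0 + (f (p (insert a (insert b J)))).untopD 0 := by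
    intro J a b ha hb' hJ haJ hbJ hab
    have haJ' : a ∉ insert b J := by simp [haJ, hab.ne]
    rw [Finset.mem_range] at ha hb'
    -- At each coordinate the parts increase with the index and never take opposite signs. So for a
    -- < b half the sum of the two parts rounds up to part b and down to part a. At i₀ both parts
    -- are 1 or both -1, so the distance is exactly 2.
    refine hf.local_le_untopD (hmem hJ) (hmem ?_) ⟨fun i => ?_, i₀, ?_⟩ (fun i => ?_)
      fun i => ?_
    · simp [Finset.insert_subset_iff, ha, hb', hJ]
    · have := hb i
      simp only [hp, Pi.sub_apply, Finset.sum_insert haJ', Finset.sum_insert hbJ, unitPart]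
      split_ifs <;> omega
    · simp only [hp, Pi.sub_apply, Finset.sum_insert haJ', Finset.sum_insert hbJ, unitPart]
      split_ifs <;> omega
    · have := hb i
      simp only [hp, Finset.sum_insert haJ', Finset.sum_insert hbJ]
      generalize ∑ k ∈ J, unitPart m k (y i - x i) = s
      simp only [unitPart]
      split_ifs <;> omega
    · have := hb i
      simp only [hp, Finset.sum_insert haJ', Finset.sum_insert haJ, Finset.sum_insert hbJ]
      generalize ∑ k ∈ J, unitPart m k (y i - x i) = s
      simp only [unitPart]
      split_ifs <;> omega
  have h := add_compl_le_of_local (g := fun J => (f (p J)).untopD 0) (U := Finset.range m)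
    (fun J a b ha hb hJ haJ hbJ hab => by
      rcases lt_or_gt_of_ne hab with h | h
      · have := hlt J a b ha hb hJ haJ hbJ h
        linarith
      · have := hlt J b a hb ha hJ hbJ haJ h
        rw [Finset.insert_comm] at this
        exact this) hJ
  have e0 : p ∅ = x := by funext i; simp [hp]
  have e1 : p (Finset.range m) = y := by
    funext i
    simp only [hp]
    rw [sum_unitPart m _ (hb i).1 (hb i).2]
    ring
  have e2 : p (Finset.range m \ J) = v := by
    funext i
    have := Finset.sum_sdiff (f := fun k => unitPart m k (y i - x i)) hJ
    rw [sum_unitPart m _ (hb i).1 (hb i).2] at this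
    rw [hv]
    simp only [hp]
    linarith
  have e3 : p J = u := funext fun i => (hu i).symm
  have mu := hmem hJ
  have mv := hmem (Finset.sdiff_subset (s := Finset.range m) (t := J))
  rw [e3] at mu
  rw [e2] at mv
  simp only [e0, e1, e2, e3] at h
  rw [mem_effDom] at hx hy mu mv
  lift f x to ℝ using hx.ne with a
  lift f y to ℝ using hy.ne with b
  lift f u to ℝ using mu.ne with c
  lift f v to ℝ using mv.ne with d
  simp only [WithTop.untopD_coe] at h
  exact_mod_cast h

/-- Cancel f x in the parallelogram inequality; if f y = ⊤ there is nothing to prove. -/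
theorem exchange (hf : LocallyDiscreteMidpointConvex f) {m : ℕ} {x y u v : Fin n → ℤ}
    (hx : x ∈ effDom f) (hd : HasSupNorm m (y - x)) {J : Finset ℕ}
    (hJ : J ⊆ Finset.range m) (hu : ∀ i, u i = x i + ∑ k ∈ J, unitPart m k (y i - x i))
    (hv : ∀ i, v i = y i - ∑ k ∈ J, unitPart m k (y i - x i)) (hxu : f x ≤ f u) :
    f v ≤ f y := by
  rcases eq_or_lt_of_le (le_top (a := f y)) with hy | hy
  · rw [hy]; exact le_top
  have h := hf.parallelogram hx hy hd hJ hu hv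
  exact (WithTop.add_le_add_iff_left hx.ne).1 ((add_le_add_left hxu _).trans h)

/-! ### Local optimality, box growth and proximity -/

/-- Part 0 lies in the unit ball, so it can be removed from z - c without increasing f; each removal
lowers the norm by one. -/
theorem le_of_forall_unit_ball (hf : LocallyDiscreteMidpointConvex f) {c : Fin n → ℤ}
    (hc : c ∈ effDom f) (hmin : ∀ z, (∀ i, -1 ≤ z i - c i ∧ z i - c i ≤ 1) → f c ≤ f z)
    (z : Fin n → ℤ) : f c ≤ f z := by
  have key : ∀ m : ℕ, ∀ z : Fin n → ℤ, (∀ i, -(m : ℤ) ≤ z i - c i ∧ z i - c i ≤ m) →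
      f c ≤ f z := by
    intro m
    induction m with
    | zero => exact fun z hz => hmin z fun i => by have := hz i; omega
    | succ m ih =>
      intro z hz
      by_cases hatt : ∃ i, z i - c i = (m + 1 : ℕ) ∨ z i - c i = -((m + 1 : ℕ) : ℤ)
      · rcases Nat.eq_zero_or_pos m with rfl | hm
        · exact hmin z fun i => by have := hz i; omega
        refine le_trans (ih (fun i => z i - unitPart (m + 1) 0 (z i - c i)) fun i => ?_)
          (hf.exchange hc ⟨hz, hatt⟩ (J := {0}) (by simp)
          (u := fun i => c i + unitPart (m + 1) 0 (z i - c i)) (by simp) (by simp)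
          (hmin _ fun i => ?_))
        · have := hz i
          simp only [unitPart]
          split_ifs <;> omega
        · simp only [unitPart]
          split_ifs <;> omega
      · push Not at hatt
        exact ih z fun i => by have := hz i; have := hatt i; omega
  refine key (Finset.univ.sup fun i => (z i - c i).natAbs) z fun i => ?_
  have := Finset.le_sup (f := fun i => (z i - c i).natAbs) (Finset.mem_univ i)
  omega

/-- While the norm is at least 3, remove part 1. It is nonzero only where |z - c| ≥ 2, so adding it
to c stays in the box of radius r, where c is minimal. Part 0 would not do: it also moves
coordinates with z - c = -1, where c may be on the boundary. -/
theorem exists_le_near_of_box (hf : LocallyDiscreteMidpointConvex f) {c : Fin n → ℤ}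
    (hc : c ∈ effDom f) {r : ℤ} (hcr : ∀ i, -r ≤ c i ∧ c i ≤ r)
    (hmin : ∀ z : Fin n → ℤ, (∀ i, -r ≤ z i ∧ z i ≤ r) → f c ≤ f z) (z : Fin n → ℤ)
    (hz : ∀ i, -(r + 1) ≤ z i ∧ z i ≤ r + 1) :
    ∃ z' : Fin n → ℤ, (∀ i, -(r + 1) ≤ z' i ∧ z' i ≤ r + 1) ∧
      (∀ i, -2 ≤ z' i - c i ∧ z' i - c i ≤ 2) ∧ f z' ≤ f z := by
  have key : ∀ m : ℕ, ∀ z : Fin n → ℤ, (∀ i, -(r + 1) ≤ z i ∧ z i ≤ r + 1) →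
      (∀ i, -(m : ℤ) ≤ z i - c i ∧ z i - c i ≤ m) →
      ∃ z' : Fin n → ℤ, (∀ i, -(r + 1) ≤ z' i ∧ z' i ≤ r + 1) ∧
      (∀ i, -2 ≤ z' i - c i ∧ z' i - c i ≤ 2) ∧ f z' ≤ f z := by
    intro m
    induction m with
    | zero => exact fun z hz hd => ⟨z, hz, fun i => by have := hd i; omega, le_rfl⟩
    | succ m ih =>
      intro z hz hd
      by_cases hatt : ∃ i, z i - c i = (m + 1 : ℕ) ∨ z i - c i = -((m + 1 : ℕ) : ℤ)
      · by_cases hm : m < 2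
        · exact ⟨z, hz, fun i => by have := hd i; omega, le_rfl⟩
        obtain ⟨z', h1, h2, h3⟩ := ih (fun i => z i - unitPart (m + 1) 1 (z i - c i))
          (fun i => by
            have := hz i; have := hd i; have := hcr i
            simp only [unitPart]
            split_ifs <;> omega)
          (fun i => by
            have := hd i
            simp only [unitPart]
            split_ifs <;> omega)
        refine ⟨z', h1, h2, h3.trans (hf.exchange hc ⟨hd, hatt⟩ (J := {1})
          (by simp; omega)
          (u := fun i => c i + unitPart (m + 1) 1 (z i - c i)) (by simp) (by simp)
          (hmin _ fun i => ?_))⟩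
        have := hz i; have := hd i; have := hcr i
        simp only [unitPart]
        split_ifs <;> omega
      · push Not at hatt
        exact ih z hz fun i => by have := hd i; have := hatt i; omega
  refine key (Finset.univ.sup fun i => (z i - c i).natAbs) z hz fun i => ?_
  have := Finset.le_sup (f := fun i => (z i - c i).natAbs) (Finset.mem_univ i)
  omega

/-- If all consecutive parts differed, monotonicity would raise the coordinate sum by at least m - 1
from first part to last. But coordinate i₀ is constant and every other one rises by at most 1, a
total of at most n - 1. -/
theorem _root_.HasSupNorm.exists_unitPart_eq {m : ℕ} {d : Fin n → ℤ} (hd : HasSupNorm m d)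
    (hm : n < m) : ∃ k, k + 1 < m ∧ ∀ i, unitPart m k (d i) = unitPart m (k + 1) (d i) := by
  by_contra hc
  push Not at hc
  obtain ⟨hb, i₀, hi₀⟩ := hd
  have mono : ∀ k i, unitPart m k (d i) ≤ unitPart m (k + 1) (d i) := fun k i => by
    simp only [unitPart]
    split_ifs <;> omega
  have grow : ∀ k, k < m → ∑ i, unitPart m 0 (d i) + k ≤ ∑ i, unitPart m k (d i) := by
    intro k
    induction k with
    | zero => simp
    | succ k ih =>
      intro hk
      obtain ⟨i, hi⟩ := hc k hk
      have := Finset.sum_lt_sum (fun i _ => mono k i)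
        ⟨i, Finset.mem_univ i, lt_of_le_of_ne (mono k i) hi⟩
      have := ih (by omega)
      push_cast
      omega
  have h1 := grow (m - 1) (by omega)
  have h2 : ∑ i, unitPart m (m - 1) (d i) ≤
      ∑ i, (unitPart m 0 (d i) + if i = i₀ then 0 else 1) := by
    refine Finset.sum_le_sum fun i _ => ?_
    have := hb i
    by_cases h : i = i₀
    · subst h
      simp only [unitPart, if_true]
      split_ifs <;> omega
    · simp only [unitPart, if_neg h]
      split_ifs <;> omega
  have h3 : ∑ i : Fin n, (if i = i₀ then (0 : ℤ) else 1) + 1 = n := by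
    rw [← Finset.add_sum_erase _ _ (Finset.mem_univ i₀), if_pos rfl,
      Finset.sum_congr rfl fun i hi => if_neg (Finset.ne_of_mem_erase hi)]
    have : 0 < n := i₀.pos
    simp
    omega
  rw [Finset.sum_add_distrib] at h2
  omega

/-- As long as the norm exceeds n there are two equal consecutive parts. Their sum is even, so
adding it to c does not lower f, and by exchange removing it from z - c does not increase f. -/
theorem exists_le_near_of_le_two_mul (hf : LocallyDiscreteMidpointConvex f) {c : Fin n → ℤ}
    (hc : c ∈ effDom f) (hmin : ∀ w : Fin n → ℤ, f c ≤ f (fun i => c i + 2 * w i))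
    (z : Fin n → ℤ) :
    ∃ z' : Fin n → ℤ, (∀ i, -(n : ℤ) ≤ z' i - c i ∧ z' i - c i ≤ n) ∧ f z' ≤ f z := by
  have key : ∀ m : ℕ, ∀ z : Fin n → ℤ, (∀ i, -(m : ℤ) ≤ z i - c i ∧ z i - c i ≤ m) →
      ∃ z' : Fin n → ℤ, (∀ i, -(n : ℤ) ≤ z' i - c i ∧ z' i - c i ≤ n) ∧ f z' ≤ f z := by
    intro m
    induction m with
    | zero => exact fun z hz => ⟨z, fun i => by have := hz i; omega, le_rfl⟩
    | succ m ih =>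
      intro z hz
      by_cases hatt : ∃ i, z i - c i = (m + 1 : ℕ) ∨ z i - c i = -((m + 1 : ℕ) : ℤ)
      · by_cases hm : m + 1 ≤ n
        · exact ⟨z, fun i => by have := hz i; omega, le_rfl⟩
        obtain ⟨k, hk, he⟩ := HasSupNorm.exists_unitPart_eq (d := z - c) ⟨hz, hatt⟩ (by omega)
        obtain ⟨z', h1, h2⟩ := ih (fun i => z i - 2 * unitPart (m + 1) k (z i - c i))
          (fun i => by
            have := hz i
            have := he i
            revert this
            simp only [unitPart, Pi.sub_apply]
            split_ifs <;> omega)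
        have hs : ∀ i, ∑ j ∈ {k, k + 1}, unitPart (m + 1) j (z i - c i) =
            2 * unitPart (m + 1) k (z i - c i) := fun i => by
          have := he i
          rw [Pi.sub_apply] at this
          rw [Finset.sum_pair (by omega), ← this, two_mul]
        refine ⟨z', h1, h2.trans (hf.exchange hc ⟨hz, hatt⟩ (J := {k, k + 1})
          (by simp [Finset.insert_subset_iff]; omega)
          (u := fun i => c i + 2 * unitPart (m + 1) k (z i - c i))
          (fun i => by rw [hs]) (fun i => by rw [hs]) (hmin _))⟩
      · push Not at hatt
        exact ih z fun i => by have := hz i; have := hatt i; omega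
  refine key (Finset.univ.sup fun i => (z i - c i).natAbs) z fun i => ?_
  have := Finset.le_sup (f := fun i => (z i - c i).natAbs) (Finset.mem_univ i)
  omega

/-! ### Stability under scaling by powers of two -/

theorem scaledFun_one (hf : LocallyDiscreteMidpointConvex f) (x : Fin n → ℤ) :
    LocallyDiscreteMidpointConvex (scaledFun f x 1) := by
  constructor
  · intro y hy z hz h
    rw [two_le_dist_iff] at h
    obtain ⟨i, hi⟩ := h
    have far : ∃ i, 2 ≤ (x + 1 • z) i - (x + 1 • y) i ∨ (x + 1 • z) i - (x + 1 • y) i ≤ -2 :=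
      ⟨i, by simp; omega⟩
    refine ⟨hf.1.up hy hz far fun j => ?_, hf.1.down hy hz far fun j => ?_⟩
    · simp [midUp_apply]; omega
    · simp [midDown_apply]; omega
  · intro y z h
    obtain ⟨i, hi⟩ := (two_le_dist_iff y z).1 h.ge
    have hle := (dist_le_natCast_iff y z 2).1 (by exact_mod_cast h.le)
    refine hf.local_le ⟨fun j => ?_, i, ?_⟩ (fun j => ?_) fun j => ?_
    · have := hle j; simp at *; omega
    · have := hle i; simp at *; omega
    · simp [midUp_apply]; omega
    · simp [midDown_apply]; omega

theorem scaledFun_zero_two (hf : LocallyDiscreteMidpointConvex f) :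
    LocallyDiscreteMidpointConvex (scaledFun f 0 2) := by
  -- the midpoints of `2y, 2z` are halfway on lattice paths through the midpoints `p, q` of
  -- `2y, y + z` and `p', q'` of `y + z, 2z`
  have pts : ∀ y z : Fin n → ℤ, (0 + 2 • y) ∈ effDom f → (0 + 2 • z) ∈ effDom f →
      (∃ i, 2 ≤ z i - y i ∨ z i - y i ≤ -2) →
      (fun i => y i + z i) ∈ effDom f ∧
      (fun i => (3 * y i + z i + 1) / 2) ∈ effDom f ∧ (fun i => (3 * y i + z i) / 2) ∈ effDom f ∧
      (fun i => (y i + 3 * z i + 1) / 2) ∈ effDom f ∧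
      (fun i => (y i + 3 * z i) / 2) ∈ effDom f := by
    rintro y z hy hz ⟨i, hi⟩
    have hm : (fun i => y i + z i) ∈ effDom f := hf.1.up hy hz ⟨i, by simp; omega⟩ fun j => by
      simp; omega
    refine ⟨hm, hf.1.up hy hm ⟨i, ?_⟩ fun j => ?_, hf.1.down hy hm ⟨i, ?_⟩ fun j => ?_,
      hf.1.up hm hz ⟨i, ?_⟩ fun j => ?_, hf.1.down hm hz ⟨i, ?_⟩ fun j => ?_⟩ <;> simp <;> omega
  constructor
  · intro y hy z hz h
    rw [two_le_dist_iff] at h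
    obtain ⟨hm, hp, hq, hp', hq'⟩ := pts y z hy hz h
    obtain ⟨i, hi⟩ := h
    refine ⟨hf.1.up hp hp' ⟨i, ?_⟩ fun j => ?_, hf.1.down hq hq' ⟨i, ?_⟩ fun j => ?_⟩
    · omega
    · simp [midUp_apply, two_mul_ceil_midpoint]
    · omega
    · simp [midDown_apply, two_mul_floor_midpoint]
  · intro y z h
    by_cases hy : (0 + 2 • y) ∈ effDom f
    swap
    · simp only [mem_effDom, not_lt_top_iff] at hy
      simp only [scaledFun, hy, top_add, le_top]
    by_cases hz : (0 + 2 • z) ∈ effDom f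
    swap
    · simp only [mem_effDom, not_lt_top_iff] at hz
      simp only [scaledFun, hz, add_top, le_top]
    have hle := (dist_le_natCast_iff y z 2).1 (by exact_mod_cast h.le)
    have far := (two_le_dist_iff y z).1 h.ge
    obtain ⟨hm, hp, hq, hp', hq'⟩ := pts y z hy hz far
    obtain ⟨i, hi⟩ := far
    have i1 := hf.local_le_untopD hy hm (u := fun i => (3 * y i + z i + 1) / 2)
      (v := fun i => (3 * y i + z i) / 2)
      ⟨fun j => by have := hle j; simp; omega, i, by have := hle i; simp; omega⟩
      (fun j => by simp; omega) (fun j => by simp; omega)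
    have i2 := hf.local_le_untopD hm hz (u := fun i => (y i + 3 * z i + 1) / 2)
      (v := fun i => (y i + 3 * z i) / 2)
      ⟨fun j => by have := hle j; simp; omega, i, by have := hle i; simp; omega⟩
      (fun j => by simp; omega) (fun j => by simp; omega)
    have i3 := hf.local_le_untopD hp hp' (u := 0 + 2 • midUp y z) (v := fun i => y i + z i)
      ⟨fun j => by have := hle j; simp only [Pi.sub_apply]; omega, i, by
        have := hle i; simp only [Pi.sub_apply]; omega⟩
      (fun j => by simp [midUp_apply, two_mul_ceil_midpoint]) (fun j => by omega)
    have i4 := hf.local_le_untopD hq hq' (u := fun i => y i + z i) (v := 0 + 2 • midDown y z)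
      ⟨fun j => by have := hle j; simp only [Pi.sub_apply]; omega, i, by
        have := hle i; simp only [Pi.sub_apply]; omega⟩
      (fun j => by omega) (fun j => by simp [midDown_apply, two_mul_floor_midpoint])
    have mu : (0 + 2 • midUp y z) ∈ effDom f := hf.1.up hp hp' ⟨i, by omega⟩
      fun j => by simp [midUp_apply, two_mul_ceil_midpoint]
    have mv : (0 + 2 • midDown y z) ∈ effDom f := hf.1.down hq hq' ⟨i, by omega⟩
      fun j => by simp [midDown_apply, two_mul_floor_midpoint]
    simp only [scaledFun]
    rw [mem_effDom] at hy hz mu mv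
    -- In the sum of the four inequalities the values at p, q, p', q' and both occurrences of f(y +
    -- z) cancel.
    have : (f (0 + 2 • midUp y z)).untopD 0 + (f (0 + 2 • midDown y z)).untopD 0 ≤
      (f (0 + 2 • y)).untopD 0 + (f (0 + 2 • z)).untopD 0 := by linarith
    lift f (0 + 2 • y) to ℝ using hy.ne with a
    lift f (0 + 2 • z) to ℝ using hz.ne with b
    lift f (0 + 2 • midUp y z) to ℝ using mu.ne with c
    lift f (0 + 2 • midDown y z) to ℝ using mv.ne with d
    simp only [WithTop.untopD_coe] at this
    exact_mod_cast this

theorem scaledFun_two_pow (hf : LocallyDiscreteMidpointConvex f) (x : Fin n → ℤ) (j : ℕ) :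
    LocallyDiscreteMidpointConvex (scaledFun f x (2 ^ j)) := by
  induction j with
  | zero => exact hf.scaledFun_one x
  | succ j ih =>
    have : scaledFun f x (2 ^ (j + 1)) = scaledFun (scaledFun f x (2 ^ j)) 0 2 := by
      funext y
      simp only [scaledFun, zero_add, smul_smul, pow_succ]
    rw [this]
    exact ih.scaledFun_zero_two

end LocallyDiscreteMidpointConvex

/-! ### Results and costs of evaluation programs -/

namespace EvalProg

variable {n : ℕ} {β γ : Type}

theorem result_bind (f : (Fin n → ℤ) → WithTop ℝ) (p : EvalProg n β) (g : β → EvalProg n γ) :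
    (p.bind g).result f = (g (p.result f)).result f := by
  induction p with
  | done b => rfl
  | ask x k ih => exact ih (f x)

theorem evals_bind (f : (Fin n → ℤ) → WithTop ℝ) (p : EvalProg n β) (g : β → EvalProg n γ) :
    (p.bind g).evals f = p.evals f + (g (p.result f)).evals f := by
  induction p with
  | done b => simp [bind, evals, result]
  | ask x k ih =>
    simp only [bind, evals, result, ih]
    omega

theorem result_rescale (f : (Fin n → ℤ) → WithTop ℝ) (x : Fin n → ℤ) (a : ℕ)
    (p : EvalProg n β) : (p.rescale x a).result f = p.result (scaledFun f x a) := by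
  induction p with
  | done b => rfl
  | ask y k ih => exact ih _

theorem evals_rescale (f : (Fin n → ℤ) → WithTop ℝ) (x : Fin n → ℤ) (a : ℕ)
    (p : EvalProg n β) : (p.rescale x a).evals f = p.evals (scaledFun f x a) := by
  induction p with
  | done b => rfl
  | ask y k ih => exact congrArg (· + 1) (ih _)

end EvalProg

/-! ### Correctness and cost of the scaling algorithm -/

section Scaling

variable {n : ℕ} {O : NbhdSubroutine n} {f : (Fin n → ℤ) → WithTop ℝ}

/-- The scaling algorithm passes from state `s` to state `s'` with `c` evaluations. -/
def ScalingReaches (O : NbhdSubroutine n) (f : (Fin n → ℤ) → WithTop ℝ)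
    (s s' : ScalingState n) (c : ℕ) : Prop :=
  ∃ t : ℕ, ∀ e : ℕ, (scalingNext O f)^[t] (s, e) = (s', e + c)

theorem ScalingReaches.trans {s s' s'' : ScalingState n} {c c' : ℕ}
    (h : ScalingReaches O f s s' c) (h' : ScalingReaches O f s' s'' c') :
    ScalingReaches O f s s'' (c + c') := by
  obtain ⟨t, ht⟩ := h
  obtain ⟨t', ht'⟩ := h'
  exact ⟨t' + t, fun e => by rw [Function.iterate_add_apply, ht, ht', add_assoc]⟩

theorem ScalingReaches.of_step {s s' : ScalingState n} {c : ℕ}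
    (h : (scalingStep O s).result f = s') (h' : (scalingStep O s).evals f = c) :
    ScalingReaches O f s s' c :=
  ⟨1, fun e => by simp [scalingNext, h, h']⟩

theorem scalingReaches_start (x : Fin n → ℤ) (a : ℕ) :
    ScalingReaches O f (.phase x a .start)
      (.phase x a (.loop 3 ((O 0 (fun _ => -((min 2 n : ℕ) : ℤ))
        (fun _ => ((min 2 n : ℕ) : ℤ))).result (scaledFun f x a))))
      ((O 0 (fun _ => -((min 2 n : ℕ) : ℤ))
        (fun _ => ((min 2 n : ℕ) : ℤ))).evals (scaledFun f x a)) := by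
  refine .of_step ?_ ?_ <;>
  simp only [scalingStep, descentStep, EvalProg.result_bind, EvalProg.evals_bind,
    EvalProg.result_rescale, EvalProg.evals_rescale, EvalProg.result, EvalProg.evals, add_zero]

theorem scalingReaches_loop (x y : Fin n → ℤ) (a k : ℕ) {z : Fin n → ℤ}
    (hz : (O y (fun _ => -((min k n : ℕ) : ℤ)) (fun _ => ((min k n : ℕ) : ℤ))).result
      (scaledFun f x a) = z) :
    ScalingReaches O f (.phase x a (.loop k y))
      (.phase x a (open Classical in if scaledFun f x a z = scaledFun f x a y then .output y
        else .loop (k + 1) z))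
      ((O y (fun _ => -((min k n : ℕ) : ℤ)) (fun _ => ((min k n : ℕ) : ℤ))).evals
        (scaledFun f x a) + 2) := by
  subst hz
  refine .of_step ?_ ?_ <;>
  simp only [scalingStep, descentStep, EvalProg.result_bind, EvalProg.evals_bind,
    EvalProg.result_rescale, EvalProg.evals_rescale, EvalProg.result, EvalProg.evals, add_zero] <;>
  split_ifs <;> rfl

/-- `y` minimizes `g` over the box `[-r, r]ⁿ`. -/
def IsBoxMin (g : (Fin n → ℤ) → WithTop ℝ) (r : ℕ) (y : Fin n → ℤ) : Prop :=
  (∀ i, -(r : ℤ) ≤ y i ∧ y i ≤ r) ∧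
    ∀ z : Fin n → ℤ, (∀ i, -(r : ℤ) ≤ z i ∧ z i ≤ r) → g y ≤ g z

theorem mem_box_iff {r : ℕ} {z : Fin n → ℤ} :
    z ∈ Set.Icc (fun _ => -(r : ℤ) : Fin n → ℤ) (fun _ => (r : ℤ)) ↔
      ∀ i, -(r : ℤ) ≤ z i ∧ z i ≤ r := by
  simp only [Set.mem_Icc, Pi.le_def, forall_and]

theorem IsTwoNbhdOracle.isBoxMin {g : (Fin n → ℤ) → WithTop ℝ} {F r : ℕ}
    (hO : IsTwoNbhdOracle O g F) {c : Fin n → ℤ} (hc : c ∈ effDom g)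
    (hcr : ∀ i, -(r : ℤ) ≤ c i ∧ c i ≤ r)
    (hnear : ∀ z : Fin n → ℤ, (∀ i, -(r : ℤ) ≤ z i ∧ z i ≤ r) →
      ∃ z' : Fin n → ℤ, (∀ i, -(r : ℤ) ≤ z' i ∧ z' i ≤ r) ∧
        (∀ i, -2 ≤ z' i - c i ∧ z' i - c i ≤ 2) ∧ g z' ≤ g z) :
    IsBoxMin g r ((O c (fun _ => -(r : ℤ)) (fun _ => (r : ℤ))).result g) := by
  obtain ⟨⟨-, h1⟩, h2, -⟩ := hO c _ _ hc (mem_box_iff.2 hcr)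
  refine ⟨mem_box_iff.1 h1, fun z hz => ?_⟩
  obtain ⟨z', h3, h4, h5⟩ := hnear z hz
  refine (h2 z' ?_ (mem_box_iff.2 h3)).trans h5
  rw [dist_comm]
  exact_mod_cast (dist_le_natCast_iff c z' 2).2 h4

theorem IsBoxMin.mem_effDom {g : (Fin n → ℤ) → WithTop ℝ} {r : ℕ} {y : Fin n → ℤ}
    (h : IsBoxMin g r y) (h0 : 0 ∈ effDom g) : y ∈ effDom g :=
  (h.2 0 fun i => by simp).trans_lt h0

/-- Invariant of the descent: each iterate minimizes over its whole box, not only over the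
neighborhood searched. Once k ≥ n the box no longer grows and the old minimizer serves. -/
theorem LocallyDiscreteMidpointConvex.isBoxMin_oracle {g : (Fin n → ℤ) → WithTop ℝ} {F k : ℕ}
    (hg : LocallyDiscreteMidpointConvex g) (h0 : 0 ∈ effDom g) (hO : IsTwoNbhdOracle O g F)
    {y : Fin n → ℤ} (hy : IsBoxMin g (min k n) y) :
    IsBoxMin g (min (k + 1) n) ((O y (fun _ => -((min (k + 1) n : ℕ) : ℤ))
      (fun _ => ((min (k + 1) n : ℕ) : ℤ))).result g) := by
  refine hO.isBoxMin (hy.mem_effDom h0) (fun i => ?_) fun z hz => ?_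
  · have := hy.1 i
    omega
  · rcases Nat.lt_or_ge k n with hk | hk
    · obtain ⟨z', h1, h2, h3⟩ := hg.exists_le_near_of_box (hy.mem_effDom h0) (r := k)
        (fun i => by have := hy.1 i; omega)
        (fun z hz => hy.2 z fun i => by have := hz i; omega) z
        (fun i => by have := hz i; omega)
      exact ⟨z', fun i => by have := h1 i; omega, h2, h3⟩
    · have e : min (k + 1) n = min k n := by omega
      rw [e] at hz ⊢
      exact ⟨y, hy.1, fun i => by omega, hy.2 z hz⟩

/-- Correctness of the stopping test: for k < n a tie means that y is also minimal over the next
box, which contains the unit ball around y, so y is a global minimizer. -/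
theorem LocallyDiscreteMidpointConvex.isBoxMin_of_eq {g : (Fin n → ℤ) → WithTop ℝ} {k : ℕ}
    (hg : LocallyDiscreteMidpointConvex g) (h0 : 0 ∈ effDom g) {y z : Fin n → ℤ}
    (hy : IsBoxMin g (min k n) y) (hz : IsBoxMin g (min (k + 1) n) z) (h : g z = g y) :
    IsBoxMin g n y := by
  refine ⟨fun i => by have := hy.1 i; omega, fun w hw => ?_⟩
  rcases Nat.lt_or_ge k n with hk | hk
  · refine hg.le_of_forall_unit_ball (hy.mem_effDom h0) (fun w hw => ?_) w
    rw [← h]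
    refine hz.2 w fun i => ?_
    have := hy.1 i
    have := hw i
    omega
  · exact hy.2 w fun i => by have := hw i; omega

/-- Here j + 1 bounds the remaining rounds: once k ≥ n the boxes coincide and the values must tie. A
round costs F evaluations for the oracle and 2 for the comparison in D2. -/
theorem exists_scalingReaches_of_loop {x : Fin n → ℤ} {a F : ℕ}
    (hg : LocallyDiscreteMidpointConvex (scaledFun f x a))
    (h0 : 0 ∈ effDom (scaledFun f x a)) (hO : IsTwoNbhdOracle O (scaledFun f x a) F) (j : ℕ) :
    ∀ (k : ℕ) (y : Fin n → ℤ), n ≤ k + j → IsBoxMin (scaledFun f x a) (min k n) y →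
      ∃ (y' : Fin n → ℤ) (c : ℕ),
        ScalingReaches O f (.phase x a (.loop (k + 1) y)) (.check (x + a • y') a) c ∧
        IsBoxMin (scaledFun f x a) n y' ∧ c ≤ (j + 1) * (F + 2) := by
  induction j with
  | zero =>
    intro k y hkn hy
    have hz := hg.isBoxMin_oracle h0 hO hy
    have hs := scalingReaches_loop (O := O) (f := f) x y a (k + 1) rfl
    have e : min (k + 1) n = min k n := by omega
    rw [if_pos (le_antisymm (hz.2 y fun i => by rw [e]; exact hy.1 i)
      (hy.2 _ fun i => by rw [← e]; exact hz.1 i))] at hs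
    have hF := (hO y _ _ (hy.mem_effDom h0) ((mem_box_iff (r := min (k + 1) n)).2 fun i => by
      rw [e]; exact hy.1 i)).2.2
    refine ⟨y, _, hs.trans (.of_step rfl rfl), ?_, ?_⟩
    · rwa [show min k n = n by omega] at hy
    · simpa [EvalProg.evals, scalingStep] using hF
  | succ j ih =>
    intro k y hkn hy
    have hz := hg.isBoxMin_oracle h0 hO hy
    have hF := (hO y _ _ (hy.mem_effDom h0) ((mem_box_iff (r := min (k + 1) n)).2 fun i => by
      have := hy.1 i; omega)).2.2
    have hs := scalingReaches_loop (O := O) (f := f) x y a (k + 1) rfl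
    set z := (O y (fun _ => -((min (k + 1) n : ℕ) : ℤ))
      (fun _ => ((min (k + 1) n : ℕ) : ℤ))).result (scaledFun f x a)
    by_cases h : scaledFun f x a z = scaledFun f x a y
    · rw [if_pos h] at hs
      refine ⟨y, _, hs.trans (.of_step rfl rfl), hg.isBoxMin_of_eq h0 hy hz h, ?_⟩
      simp only [EvalProg.evals, scalingStep]
      nlinarith
    · rw [if_neg h] at hs
      obtain ⟨y', c, h1, h2, h3⟩ := ih (k + 1) z (by omega) hz
      refine ⟨y', _, hs.trans h1, h2, ?_⟩
      rw [add_mul (j + 1), one_mul]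
      omega

/-- One call for S_2, then at most max(1, n - 1) rounds of cost F + 2; the constant 7 absorbs
everything since n, F ≥ 1. -/
theorem exists_scalingReaches_of_start {x : Fin n → ℤ} {a F : ℕ}
    (hg : LocallyDiscreteMidpointConvex (scaledFun f x a))
    (h0 : 0 ∈ effDom (scaledFun f x a)) (hO : IsTwoNbhdOracle O (scaledFun f x a) F)
    (hn : 1 ≤ n) (hF : 1 ≤ F) :
    ∃ (y : Fin n → ℤ) (c : ℕ),
      ScalingReaches O f (.phase x a .start) (.check (x + a • y) a) c ∧
      IsBoxMin (scaledFun f x a) n y ∧ c ≤ 7 * (n * F) := by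
  have hb : ∀ i : Fin n, -((min 2 n : ℕ) : ℤ) ≤ (0 : Fin n → ℤ) i ∧
      (0 : Fin n → ℤ) i ≤ (min 2 n : ℕ) := fun i => by
    simp only [Pi.zero_apply]; omega
  have hz := hO.isBoxMin (r := min 2 n) h0 hb fun z hz =>
    ⟨z, hz, fun i => by have := hz i; simp only [Pi.zero_apply]; omega, le_rfl⟩
  have hc := (hO 0 _ _ h0 (mem_box_iff.2 hb)).2.2
  rcases Nat.lt_or_ge n 2 with hn2 | hn2
  · obtain ⟨y, c, h1, h2, h3⟩ := exists_scalingReaches_of_loop hg h0 hO 0 2 _ (by omega) hz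
    refine ⟨y, _, (scalingReaches_start x a).trans h1, h2, ?_⟩
    nlinarith [Nat.mul_le_mul hn hF, Nat.mul_le_mul_right F hn]
  · obtain ⟨y, c, h1, h2, h3⟩ := exists_scalingReaches_of_loop hg h0 hO (n - 2) 2 _ (by omega) hz
    refine ⟨y, _, (scalingReaches_start x a).trans h1, h2, ?_⟩
    obtain ⟨l, rfl⟩ := Nat.exists_eq_add_of_le hn2
    rw [Nat.add_sub_cancel_left] at h3
    nlinarith

/-- Invariant over the phases: in the current scale, the box of radius n around x contains a
competitor to every point. Box minimality of y is then global at scale 2^(j+1), and the proximity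
bound restores the invariant at scale 2^j. -/
theorem exists_scalingReaches_halted (hf : LocallyDiscreteMidpointConvex f) {F : ℕ}
    (hn : 1 ≤ n) (hF : 1 ≤ F)
    (hO : ∀ x ∈ effDom f, ∀ a : ℕ, 0 < a → IsTwoNbhdOracle O (scaledFun f x a) F) (j : ℕ) :
    ∀ x ∈ effDom f, (∀ z : Fin n → ℤ, ∃ z' : Fin n → ℤ, (∀ i, -(n : ℤ) ≤ z' i ∧ z' i ≤ n) ∧
        scaledFun f x (2 ^ j) z' ≤ scaledFun f x (2 ^ j) z) →
      ∃ (x' : Fin n → ℤ) (c : ℕ),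
        ScalingReaches O f (.phase x (2 ^ j) .start) (.halted x') c ∧ (∀ z, f x' ≤ f z) ∧
        c ≤ (j + 1) * (7 * (n * F)) := by
  have zero_mem : ∀ {x : Fin n → ℤ} (a : ℕ), x ∈ effDom f → 0 ∈ effDom (scaledFun f x a) :=
    fun a hx => by simpa [effDom, scaledFun] using hx
  induction j with
  | zero =>
    intro x hx hnear
    obtain ⟨y, c, h1, h2, h3⟩ := exists_scalingReaches_of_start (hf.scaledFun_two_pow x 0)
      (zero_mem _ hx) (hO x hx _ (by positivity)) hn hF
    refine ⟨x + 2 ^ 0 • y, c + 0, h1.trans (.of_step ?_ ?_), fun z => ?_, by simpa using h3⟩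
    · simp [scalingStep, EvalProg.result]
    · simp [scalingStep, EvalProg.evals]
    · obtain ⟨z', h4, h5⟩ := hnear (z - x)
      have := (h2.2 z' h4).trans h5
      simpa [scaledFun] using this
  | succ j ih =>
    intro x hx hnear
    obtain ⟨y, c, h1, h2, h3⟩ := exists_scalingReaches_of_start (hf.scaledFun_two_pow x (j + 1))
      (zero_mem _ hx) (hO x hx _ (by positivity)) hn hF
    have hx' : x + 2 ^ (j + 1) • y ∈ effDom f := h2.mem_effDom (zero_mem _ hx)
    obtain ⟨x', c', h4, h5, h6⟩ := ih _ hx' fun z => by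
      obtain ⟨z', hz', hle⟩ := (hf.scaledFun_two_pow (x + 2 ^ (j + 1) • y) j
        ).exists_le_near_of_le_two_mul (zero_mem _ hx') (fun w => by
          obtain ⟨w', h4, h5⟩ := hnear (y + w)
          have := (h2.2 w' h4).trans h5
          have e1 : scaledFun f (x + 2 ^ (j + 1) • y) (2 ^ j) 0 = scaledFun f x (2 ^ (j + 1)) y := by
            simp [scaledFun]
          have e2 : scaledFun f (x + 2 ^ (j + 1) • y) (2 ^ j)
              (fun i => (0 : Fin n → ℤ) i + 2 * w i) = scaledFun f x (2 ^ (j + 1)) (y + w) := by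
            simp only [scaledFun]
            congr 1
            funext i
            simp [pow_succ]
            ring
          rwa [e1, e2]) z
      exact ⟨z', fun i => by have := hz' i; simpa using this, hle⟩
    refine ⟨x', _, (h1.trans (.of_step (c := 0) ?_ ?_)).trans h4, h5, ?_⟩
    · have : (2 : ℕ) ^ (j + 1) ≠ 1 := by simp
      simp only [scalingStep, if_neg this, EvalProg.result]
      rw [pow_succ, Nat.mul_div_cancel _ (by norm_num)]
    · have : (2 : ℕ) ^ (j + 1) ≠ 1 := by simp
      simp only [scalingStep, if_neg this, EvalProg.evals]
    · rw [add_mul (j + 1), one_mul]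
      omega

theorem exists_scalingHaltsWith (hf : LocallyDiscreteMidpointConvex f)
    (hbd : Bornology.IsBounded (effDom f)) (hK : 0 < domSize f) {F : ℕ} (hF : 1 ≤ F)
    (hO : ∀ x ∈ effDom f, ∀ a : ℕ, 0 < a → IsTwoNbhdOracle O (scaledFun f x a) F)
    {x₀ : Fin n → ℤ} (hx₀ : x₀ ∈ effDom f) :
    ∃ (x : Fin n → ℤ) (c : ℕ), ScalingHaltsWith O f x₀ x c ∧ (∀ z, f x ≤ f z) ∧
      (c : ℝ) ≤ 21 * (n * F * max 1 (Real.logb 2 (domSize f))) := by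
  have hn : 1 ≤ n := by
    by_contra h
    obtain rfl : n = 0 := by omega
    exact hK.ne' (Metric.diam_subsingleton Set.subsingleton_of_subsingleton)
  set j := ⌈Real.logb 2 (domSize f)⌉₊ with hj
  have hKj : domSize f ≤ (2 ^ j : ℕ) := by
    have h1 := Nat.le_ceil (Real.logb 2 (domSize f))
    rw [Real.logb_le_iff_le_rpow (by norm_num) hK, Real.rpow_natCast] at h1
    exact_mod_cast h1
  obtain ⟨x, c, ⟨t, ht⟩, h2, h3⟩ := exists_scalingReaches_halted hf hn hF hO j x₀ hx₀ fun z => by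
    rcases eq_or_lt_of_le (le_top (a := scaledFun f x₀ (2 ^ j) z)) with hz | hz
    · exact ⟨0, fun i => by simp, by rw [hz]; exact le_top⟩
    · refine ⟨z, fun i => ?_, le_rfl⟩
      have h1 := (Metric.dist_le_diam_of_mem hbd hx₀ hz).trans hKj
      have h2 := (dist_le_natCast_iff _ _ _).1 h1 i
      have hpos : (0 : ℤ) < (2 ^ j : ℕ) := by positivity
      simp only [Pi.add_apply, Pi.smul_apply, add_sub_cancel_left] at h2
      rw [nsmul_eq_mul] at h2
      -- The initial scaling unit is at least K_∞, so feasible points of the scaled function have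
      -- coordinates in [-1, 1], and n ≥ 1.
      have h3 : z i ≤ 1 := by nlinarith
      have h4 : -1 ≤ z i := by nlinarith
      omega
  refine ⟨x, c, ⟨t, by rw [ht 0, zero_add]⟩, h2, ?_⟩
  -- If log₂ K_∞ ≥ 0 then j + 1 < log₂ K_∞ + 2; otherwise j = 0. With cost 7nF per phase this gives
  -- 21 = 3 · 7.
  have h4 : (j : ℝ) + 1 ≤ 3 * max 1 (Real.logb 2 (domSize f)) := by
    have h5 := le_max_left 1 (Real.logb 2 (domSize f))
    have h6 := le_max_right 1 (Real.logb 2 (domSize f))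
    rcases le_or_gt 0 (Real.logb 2 (domSize f)) with h | h
    · have := Nat.ceil_lt_add_one h
      linarith
    · have : j = 0 := Nat.ceil_eq_zero.2 h.le
      rw [this, Nat.cast_zero]
      linarith
  calc (c : ℝ) ≤ ((j + 1) * (7 * (n * F)) : ℕ) := by exact_mod_cast h3
    _ = (j + 1) * (7 * (n * F)) := by push_cast; ring
    _ ≤ 3 * max 1 (Real.logb 2 (domSize f)) * (7 * (n * F)) := by gcongr
    _ = 21 * (n * F * max 1 (Real.logb 2 (domSize f))) := by ring

end Scaling

/-! ### The exhaustive oracle with 5ⁿ evaluations -/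

section BruteForce

variable {n : ℕ}

/-- Evaluate the points of a list one after the other, keeping the best point found so far and its
value. -/
noncomputable def searchList : List (Fin n → ℤ) → (Fin n → ℤ) → WithTop ℝ → EvalProg n (Fin n → ℤ)
  | [], b, _ => .done b
  | z :: l, b, v => .ask z fun w => open Classical in
      if w < v then searchList l z w else searchList l b v

theorem evals_searchList (g : (Fin n → ℤ) → WithTop ℝ) (l : List (Fin n → ℤ)) :
    ∀ b v, (searchList l b v).evals g = l.length := by
  induction l with
  | nil => intro b v; rfl
  | cons z l ih =>
    intro b v
    simp only [searchList, EvalProg.evals, List.length_cons]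
    split_ifs <;> rw [ih]

theorem result_searchList (g : (Fin n → ℤ) → WithTop ℝ) (l : List (Fin n → ℤ)) :
    ∀ b v, (((searchList l b v).result g = b ∧ ∀ z ∈ l, v ≤ g z) ∨
      ((searchList l b v).result g ∈ l ∧ g ((searchList l b v).result g) ≤ v ∧
        ∀ z ∈ l, g ((searchList l b v).result g) ≤ g z)) := by
  induction l with
  | nil => intro b v; left; simp [searchList, EvalProg.result]
  | cons z l ih =>
    intro b v
    simp only [searchList, EvalProg.result, List.mem_cons, forall_eq_or_imp]
    split_ifs with h
    · right
      rcases ih z (g z) with ⟨h1, h2⟩ | ⟨h1, h2, h3⟩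
      · rw [h1]
        exact ⟨.inl rfl, h.le, le_rfl, h2⟩
      · exact ⟨.inr h1, h2.trans h.le, h2, h3⟩
    · rw [not_lt] at h
      rcases ih b v with ⟨h1, h2⟩ | ⟨h1, h2, h3⟩
      · exact .inl ⟨h1, h, h2⟩
      · exact .inr ⟨.inr h1, h2, h2.trans h, h3⟩

/-- The subroutine that evaluates all points of `N₂(c) ∩ [p, q]`. -/
noncomputable def bruteForce (n : ℕ) : NbhdSubroutine n := fun c p q =>
  searchList (Finset.Icc (p ⊔ fun i => c i - 2) (q ⊓ fun i => c i + 2)).toList c ⊤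

theorem isTwoNbhdOracle_bruteForce (g : (Fin n → ℤ) → WithTop ℝ) :
    IsTwoNbhdOracle (bruteForce n) g (5 ^ n) := by
  intro c p q hc hcpq
  have hmem : ∀ z, z ∈ (Finset.Icc (p ⊔ fun i => c i - 2) (q ⊓ fun i => c i + 2)).toList ↔
      dist z c ≤ 2 ∧ z ∈ Set.Icc p q := by
    intro z
    rw [show (2 : ℝ) = (2 : ℕ) by norm_num, dist_le_natCast_iff, Finset.mem_toList, Finset.mem_Icc, sup_le_iff, le_inf_iff, Set.mem_Icc]
    simp only [Pi.le_def]
    constructor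
    · rintro ⟨⟨h1, h2⟩, h3, h4⟩
      exact ⟨fun i => by have := h2 i; have := h4 i; push_cast; omega, h1, h3⟩
    · rintro ⟨h1, h2, h3⟩
      exact ⟨⟨h2, fun i => by have := h1 i; push_cast at this; omega⟩, h3,
        fun i => by have := h1 i; push_cast at this; omega⟩
  have hcl := (hmem c).2 ⟨by simp, hcpq⟩
  rcases result_searchList g (Finset.Icc (p ⊔ fun i => c i - 2) (q ⊓ fun i => c i + 2)).toList c ⊤
    with ⟨h1, h2⟩ | ⟨h1, h2, h3⟩
  -- The initial record ⊤ survives only if every listed value is ⊤, but c is in the list and in dom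
  -- g.
  · exact absurd hc (not_lt.2 (h2 c hcl))
  · refine ⟨(hmem _).1 h1, fun z hz hz' => h3 z ((hmem z).2 ⟨hz, hz'⟩), ?_⟩
    rw [bruteForce, evals_searchList, Finset.length_toList, Pi.card_Icc]
    refine (Finset.prod_le_pow_card _ _ 5 fun i _ => ?_).trans (by simp)
    rw [Int.card_Icc]
    simp only [Pi.sup_apply, Pi.inf_apply]
    omega

end BruteForce

/-! ### The theorem -/

theorem theorem6p2 :
    ∃ C : ℝ, 0 < C ∧
      (∀ (n : ℕ) (f : (Fin n → ℤ) → WithTop ℝ),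
        (LocallyDiscreteMidpointConvex f ∨ GloballyDiscreteMidpointConvex f) →
        Bornology.IsBounded (effDom f) → 0 < domSize f →
        ∀ (O : NbhdSubroutine n) (F : ℕ), 1 ≤ F →
        (∀ x ∈ effDom f, ∀ a : ℕ, 0 < a → IsTwoNbhdOracle O (scaledFun f x a) F) →
        ∀ x₀ ∈ effDom f, ∃ (x : Fin n → ℤ) (c : ℕ),
          ScalingHaltsWith O f x₀ x c ∧ (∀ z, f x ≤ f z) ∧
          (c : ℝ) ≤ C * (n * F * max 1 (Real.logb 2 (domSize f)))) ∧
      (∀ n : ℕ, ∃ O : NbhdSubroutine n,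
        (∀ g : (Fin n → ℤ) → WithTop ℝ, IsTwoNbhdOracle O g (5 ^ n)) ∧
        ∀ f : (Fin n → ℤ) → WithTop ℝ,
          (LocallyDiscreteMidpointConvex f ∨ GloballyDiscreteMidpointConvex f) →
          Bornology.IsBounded (effDom f) → 0 < domSize f →
          ∀ x₀ ∈ effDom f, ∃ (x : Fin n → ℤ) (c : ℕ),
            ScalingHaltsWith O f x₀ x c ∧ (∀ z, f x ≤ f z) ∧
            (c : ℝ) ≤ C * (5 ^ n * n * max 1 (Real.logb 2 (domSize f)))) := by
  refine ⟨21, by norm_num, fun n f hf hbd hK O F hF hO x₀ hx₀ =>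
    exists_scalingHaltsWith (hf.elim id (·.locally)) hbd hK hF hO hx₀, fun n =>
    ⟨bruteForce n, isTwoNbhdOracle_bruteForce, fun f hf hbd hK x₀ hx₀ => ?_⟩⟩
  obtain ⟨x, c, h1, h2, h3⟩ := exists_scalingHaltsWith (hf.elim id (·.locally)) hbd hK
    (Nat.one_le_pow n 5 (by norm_num)) (fun x _ a _ => isTwoNbhdOracle_bruteForce _) hx₀
  refine ⟨x, c, h1, h2, h3.trans (le_of_eq ?_)⟩
  push_cast
  ring
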